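/- Let \(n\) be a natural number, let \(A,B\) be complex \(n\times n\) positive definite matrices and let \(a,b\ge 0\) be real numbers. Write \[ A\#B=A^{1/2}\bigl(A^{-1/2}BA^{-1/2}\bigr)^{1/2}A^{1/2} \] for the Kubo–Ando geometric mean, \(\lambda(T)\in\mathbb R^n\) for the vector of the eigenvalues (with multiplicities, in decreasing order) of a Hermitian matrix \(T\), and, for \(x,y\in\mathbb R^n\), \(x\prec_w y\) if for every \(1\le k\le n\) the sum of the \(k\) largest entries of \(x\) is at most the sum of the \(k\) largest entries of \(y\). Then \(a^2A+b^2B+2ab(A\#B)\) and \(a^2A+b^2B+ab(A^{1/2}B^{1/2}+B^{1/2}A^{1/2})=(aA^{1/2}+bB^{1/2})^2\) are Hermitian and \[ \lambda\bigl(a^2A+b^2B+2ab(A\#B)\bigr)\prec_w\lambda\bigl(a^2A+b^2B+ab(A^{1/2}B^{1/2}+B^{1/2}A^{1/2})\bigr). \] Consequently, for every unitarily invariant norm \(|\!|\!|\cdot|\!|\!|\) on the complex \(n\times n\) matrices (a norm with \(|\!|\!|UXV|\!|\!|=|\!|\!|X|\!|\!|\) for all unitary \(U,V\)), \[ |\!|\!|a^2A+b^2B+2ab(A\#B)|\!|\!|\le|\!|\!|(aA^{1/2}+bB^{1/2})^2|\!|\!|,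 \] and in particular \[ |\!|\!|A+B+2(A\#B)|\!|\!|\le|\!|\!|A+B+A^{1/2}B^{1/2}+B^{1/2}A^{1/2}|\!|\!|. \] -/

import Mathlib

open scoped MatrixOrder ComplexOrder

noncomputable section

namespace HeronMajorization

/-- The decreasing rearrangement `x↓` of a real vector `x`. -/
def decRearr {n : ℕ} (x : Fin n → ℝ) : Fin n → ℝ :=
  fun i => x (Tuple.sort x (Fin.rev i))

/-- Weak majorization `x ≺_w y` of real vectors: for `1 ≤ k ≤ n`, the sum of the `k` largest
entries of `x` is at most the sum of the `k` largest entries of `y`. -/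
def WeaklyMajorizedBy {n : ℕ} (x y : Fin n → ℝ) : Prop :=
  ∀ k : ℕ, 1 ≤ k → k ≤ n →
    ∑ j ∈ Finset.univ.filter (fun j : Fin n => (j : ℕ) < k), decRearr x j ≤
      ∑ j ∈ Finset.univ.filter (fun j : Fin n => (j : ℕ) < k), decRearr y j

/-- The vector `λ(T)` of the eigenvalues of a Hermitian matrix `T`, with multiplicities, arranged
in decreasing order. -/
def eigenvalueVector {n : ℕ} {T : Matrix (Fin n) (Fin n) ℂ} (hT : T.IsHermitian) : Fin n → ℝ :=
  fun i => hT.eigenvalues₀ (Fin.cast (Fintype.card_fin n).symm i)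

/-- The weighted Kubo-Ando geometric mean `A #_t B`, for positive definite `A` and `B`. The real
powers are those of the continuous functional calculus. -/
def weightedGeometricMean {n : ℕ} (t : ℝ) (A B : Matrix (Fin n) (Fin n) ℂ) :
    Matrix (Fin n) (Fin n) ℂ :=
  A ^ (1 / 2 : ℝ) * (A ^ (-(1 / 2) : ℝ) * B * A ^ (-(1 / 2) : ℝ)) ^ t * A ^ (1 / 2 : ℝ)

/-- The Kubo-Ando geometric mean `A # B = A #_{1/2} B`. -/
def geometricMean {n : ℕ} (A B : Matrix (Fin n) (Fin n) ℂ) : Matrix (Fin n) (Fin n) ℂ :=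
  weightedGeometricMean (1 / 2) A B

/-- A unitarily invariant norm on the complex `n × n` matrices: a norm `N` with
`N (U X V) = N X` for all unitary `U` and `V`. -/
structure IsUnitarilyInvariantNorm {n : ℕ} (N : Matrix (Fin n) (Fin n) ℂ → ℝ) : Prop where
  add_le : ∀ X Y, N (X + Y) ≤ N X + N Y
  smul_eq : ∀ (c : ℂ) (X), N (c • X) = ‖c‖ * N X
  eq_zero_of : ∀ X, N X = 0 → X = 0
  unitary_mul_mul : ∀ U ∈ Matrix.unitaryGroup (Fin n) ℂ, ∀ V ∈ Matrix.unitaryGroup (Fin n) ℂ,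
    ∀ X, N (U * X * V) = N X

end HeronMajorization

end

namespace HeronMajorization

open Matrix

/-! For `a, b > 0` put `X = aA^{1/2}`, `Y = bB^{1/2}`, `S = X + Y`. With a Hermitian `G` such that
`XG²X = Y²`, the mean `ab(A # B)` is `XGX`, so `T = X² + Y² + 2XGX` has to be compared with `S²`.

A congruence `F` with `FF* = S` gives `X = FcF*` and `Y = FdF*` with positive diagonal `c + d = 1`
(`exists_congruence_diagonal`). Put `M = F*F`, which is unitarily similar to `S`, and `Z =
F⁻¹(XGX)F⁻*`. Positivity of the block matrix of `X²`, `Y²` and `XGX` compresses to `dZc + cZd ≤ 2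
cdMcd`. A Lyapunov equation with positive diagonal coefficients has positive solutions for positive
data (`posSemidef_of_lyapunov`), so `Z` lies below the solution `L` of the corresponding equality.
Hence `T ≤ F Φ(M) F*`, where `Φ(M) = cMc + dMd + 2L` is a positive Schur multiplier map whose kernel
is `1` on the diagonal and at most `1` elsewhere.

Let `τ` be the `k`-th eigenvalue of `S`, `R = (S - τ)₊`, and `R'` its copy in the coordinates of
`M`. From `M ≤ τ + R'` and `S ≤ τ + R` follows `T ≤ τ² + τR + F Φ(R') F*`. For `0 ≤ P ≤ 1` of trace
`k`, the properties of `Φ` give `tr PT ≤ kτ² + 2τ tr R + tr R²`, which is the sum of the `k` largest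
squared eigenvalues of `S` (`trace_mul_heron_re_le`). Ky Fan's maximum principle turns this into
weak majorization, and his dominance principle passes to norms. -/

/-! ### Traces of products and diagonalization with sorted eigenvalues. -/

/-- The diagonal complex matrix with the given real entries. -/
abbrev realDiagonal {n : ℕ} (x : Fin n → ℝ) : Matrix (Fin n) (Fin n) ℂ :=
  diagonal fun i => (x i : ℂ)

lemma posSemidef_realDiagonal {n : ℕ} {x : Fin n → ℝ} (hx : ∀ i, 0 ≤ x i) :
    (realDiagonal x).PosSemidef :=
  PosSemidef.diagonal fun i => by simpa using hx i

lemma isHermitian_realDiagonal {n : ℕ} (x : Fin n → ℝ) : (realDiagonal x).IsHermitian := by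
  rw [IsHermitian, diagonal_conjTranspose]
  congr 1
  ext i
  simp

lemma trace_mul_re_nonneg {n : ℕ} {A B : Matrix (Fin n) (Fin n) ℂ} (hA : A.PosSemidef)
    (hB : B.PosSemidef) : 0 ≤ (A * B).trace.re := by
  obtain ⟨C, rfl⟩ := CStarAlgebra.nonneg_iff_eq_star_mul_self.mp hB.nonneg
  rw [star_eq_conjTranspose, ← Matrix.mul_assoc, trace_mul_comm, ← Matrix.mul_assoc]
  exact (Complex.le_def.mp (hA.mul_mul_conjTranspose_same C).trace_nonneg).1

lemma trace_mul_re_le_trace_re {n : ℕ} {P B : Matrix (Fin n) (Fin n) ℂ}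
    (hP : (1 - P).PosSemidef) (hB : B.PosSemidef) : (P * B).trace.re ≤ B.trace.re := by
  have := trace_mul_re_nonneg hP hB
  rw [Matrix.sub_mul, Matrix.one_mul, trace_sub, Complex.sub_re] at this
  linarith

lemma eigenvalueVector_antitone {n : ℕ} {T : Matrix (Fin n) (Fin n) ℂ} (hT : T.IsHermitian) :
    Antitone (eigenvalueVector hT) := fun i j hij =>
  hT.eigenvalues₀_antitone (show i.val ≤ j.val from hij)

/-- `IsHermitian.eigenvalues` is indexed through an unspecified bijection, so its order on `Fin n`
is only known up to a permutation. -/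
lemma exists_eigenvalues_eq_comp {n : ℕ} {T : Matrix (Fin n) (Fin n) ℂ} (hT : T.IsHermitian) :
    ∃ σ : Equiv.Perm (Fin n), hT.eigenvalues = eigenvalueVector hT ∘ σ :=
  ⟨(Fintype.equivOfCardEq (Fintype.card_fin _)).symm.trans (finCongr (Fintype.card_fin n)), by
    ext i; rfl⟩

/-- The matrix of a permutation is unitary, and conjugation by it permutes a diagonal matrix. -/
lemma exists_unitary_conj_realDiagonal_comp {n : ℕ} (σ : Equiv.Perm (Fin n)) :
    ∃ W ∈ unitaryGroup (Fin n) ℂ, ∀ x : Fin n → ℝ,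
      realDiagonal (x ∘ σ) = W * realDiagonal x * Wᴴ := by
  refine ⟨(1 : Matrix (Fin n) (Fin n) ℂ).submatrix σ id, ?_, fun x => ?_⟩
  · rw [mem_unitaryGroup_iff, star_eq_conjTranspose, conjTranspose_submatrix, conjTranspose_one,
      ← submatrix_mul _ _ σ id σ Function.bijective_id, Matrix.mul_one, submatrix_one_equiv]
  · ext i j
    simp [Matrix.mul_apply, diagonal_apply, one_apply]
    aesop

lemma exists_unitary_diagonalization {n : ℕ} {T : Matrix (Fin n) (Fin n) ℂ} (hT : T.IsHermitian) :
    ∃ V ∈ unitaryGroup (Fin n) ℂ, T = V * realDiagonal (eigenvalueVector hT) * Vᴴ := by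
  obtain ⟨σ, hσ⟩ := exists_eigenvalues_eq_comp hT
  obtain ⟨W, hW, h⟩ := exists_unitary_conj_realDiagonal_comp σ
  refine ⟨hT.eigenvectorUnitary * W, mul_mem hT.eigenvectorUnitary.2 hW, ?_⟩
  have h1 := hT.spectral_theorem
  rw [Unitary.conjStarAlgAut_apply] at h1
  have h2 : diagonal (RCLike.ofReal ∘ hT.eigenvalues) =
      realDiagonal (eigenvalueVector hT ∘ σ) := by
    rw [hσ]; rfl
  rw [h2, h, star_eq_conjTranspose] at h1
  rw [conjTranspose_mul]
  simpa only [Matrix.mul_assoc] using h1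

lemma eigenvalueVector_nonneg {n : ℕ} {T : Matrix (Fin n) (Fin n) ℂ} (hT : T.PosSemidef)
    (i : Fin n) : 0 ≤ eigenvalueVector hT.isHermitian i := by
  obtain ⟨σ, hσ⟩ := exists_eigenvalues_eq_comp hT.isHermitian
  have := hT.eigenvalues_nonneg (σ.symm i)
  rw [hσ] at this
  simpa using this

/-! ### Weak majorization and partial sums of decreasing vectors. -/

lemma decRearr_of_antitone {n : ℕ} {x : Fin n → ℝ} (hx : Antitone x) : decRearr x = x := by
  have h : x ∘ (Fin.revPerm : Equiv.Perm (Fin n)) = x ∘ Tuple.sort x :=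
    Tuple.comp_sort_eq_comp_iff_monotone.mpr fun i j hij => hx (by simpa using hij)
  ext i
  have := congrFun h (Fin.rev i)
  simp only [Function.comp, Fin.revPerm_apply, Fin.rev_rev] at this
  exact this.symm

lemma weaklyMajorizedBy_iff_of_antitone {n : ℕ} {x y : Fin n → ℝ} (hx : Antitone x)
    (hy : Antitone y) : WeaklyMajorizedBy x y ↔ ∀ k : ℕ, 1 ≤ k → k ≤ n →
      ∑ j with (j : Fin n).val < k, x j ≤ ∑ j with (j : Fin n).val < k, y j := by
  rw [WeaklyMajorizedBy, decRearr_of_antitone hx, decRearr_of_antitone hy]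

lemma card_filter_val_lt {n k : ℕ} (hk : k ≤ n) :
    (Finset.univ.filter fun j : Fin n => (j : ℕ) < k).card = k := by
  simp [Fin.card_filter_val_lt, hk]

/-- The threshold is the `k`-th largest entry (index `k - 1`): truncation changes nothing before it
and leaves `f 0 = 0` after it. -/
lemma sum_max_sub_eq {n k : ℕ} {x : Fin n → ℝ} (hx : Antitone x) (hk : 1 ≤ k) (hkn : k ≤ n)
    (f : ℝ → ℝ) (hf : f 0 = 0) :
    ∑ i, f (max (x i - x ⟨k - 1, by omega⟩) 0) =
      ∑ i with (i : Fin n).val < k, f (x i - x ⟨k - 1, by omega⟩) := by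
  rw [Finset.sum_filter]
  refine Finset.sum_congr rfl fun i _ => ?_
  split_ifs with h
  · rw [max_eq_left]
    exact sub_nonneg.mpr (hx (by rw [Fin.le_def]; simp; omega))
  · rw [max_eq_right, hf]
    exact sub_nonpos.mpr (hx (by rw [Fin.le_def]; simp; omega))

/-! ### Ky Fan's maximum principle. -/

/-- Ky Fan's maximum principle, the upper bound. -/
lemma trace_mul_re_le_sum_eigenvalueVector {n k : ℕ} {K P : Matrix (Fin n) (Fin n) ℂ}
    (hK : K.IsHermitian) (hP : P.PosSemidef) (hP1 : (1 - P).PosSemidef) (hk : 1 ≤ k)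
    (hkn : k ≤ n) (htr : P.trace = k) :
    (P * K).trace.re ≤ ∑ i with (i : Fin n).val < k, eigenvalueVector hK i := by
  obtain ⟨V, hV, h⟩ := exists_unitary_diagonalization hK
  set x := eigenvalueVector hK
  have hx : Antitone x := eigenvalueVector_antitone hK
  set τ := x ⟨k - 1, by omega⟩ with hτ
  have hVV : Vᴴ * V = 1 := mem_unitaryGroup_iff'.mp hV
  -- This is `K ≤ τ + (K - τ)₊`; tested against `P` it gives `tr PK ≤ kτ + tr (K - τ)₊`.
  have hle : (V * realDiagonal (fun i => τ + max (x i - τ) 0 - x i) * Vᴴ).PosSemidef :=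
    (posSemidef_realDiagonal fun i => by linarith [le_max_left (x i - τ) 0]).mul_mul_conjTranspose_same V
  have hR : (V * realDiagonal (fun i => max (x i - τ) 0) * Vᴴ).PosSemidef :=
    (posSemidef_realDiagonal fun i => le_max_right _ _).mul_mul_conjTranspose_same V
  have hVV' : V * Vᴴ = 1 := mem_unitaryGroup_iff.mp hV
  have hsplit : V * realDiagonal (fun i => τ + max (x i - τ) 0 - x i) * Vᴴ =
      (τ : ℂ) • (1 : Matrix (Fin n) (Fin n) ℂ) + V * realDiagonal (fun i => max (x i - τ) 0) * Vᴴ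
        - K := by
    have : realDiagonal (fun i => τ + max (x i - τ) 0 - x i) =
        (τ : ℂ) • (1 : Matrix (Fin n) (Fin n) ℂ) + realDiagonal (fun i => max (x i - τ) 0)
          - realDiagonal x := by
      ext i j
      by_cases hij : i = j <;> simp [hij]
    rw [this, h]
    simp only [Matrix.mul_sub, Matrix.sub_mul, Matrix.mul_add, Matrix.add_mul, Matrix.mul_smul,
      Matrix.smul_mul, Matrix.mul_one, hVV']
  have h1 := trace_mul_re_nonneg hP hle
  have h2 := trace_mul_re_le_trace_re hP1 hR
  have h3 : (V * realDiagonal (fun i => max (x i - τ) 0) * Vᴴ).trace.re =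
      ∑ i with (i : Fin n).val < k, (x i - τ) := by
    rw [trace_mul_comm, ← Matrix.mul_assoc, hVV, Matrix.one_mul, trace_diagonal, Complex.re_sum]
    simpa using sum_max_sub_eq hx hk hkn id rfl
  rw [hsplit, Matrix.mul_sub, Matrix.mul_add, trace_sub, trace_add, Matrix.mul_smul,
    Matrix.mul_one, trace_smul, htr] at h1
  rw [Finset.sum_sub_distrib, Finset.sum_const, card_filter_val_lt hkn, nsmul_eq_mul] at h3
  simp at h1
  linarith

/-- Ky Fan's maximum principle: the sum of the `k` largest eigenvalues is attained at the
projection on the span of the corresponding eigenvectors, which also computes the sum for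
the square. -/
lemma exists_projection_trace_mul_eq {n k : ℕ} {K : Matrix (Fin n) (Fin n) ℂ}
    (hK : K.IsHermitian) (hkn : k ≤ n) :
    ∃ P : Matrix (Fin n) (Fin n) ℂ, P.PosSemidef ∧ (1 - P).PosSemidef ∧ P.trace = k ∧
      (P * K).trace.re = ∑ i with (i : Fin n).val < k, eigenvalueVector hK i ∧
      (P * (K * K)).trace.re = ∑ i with (i : Fin n).val < k, eigenvalueVector hK i ^ 2 := by
  obtain ⟨V, hV, h⟩ := exists_unitary_diagonalization hK
  set x := eigenvalueVector hK
  have hVV : Vᴴ * V = 1 := mem_unitaryGroup_iff'.mp hV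
  have hVV' : V * Vᴴ = 1 := mem_unitaryGroup_iff.mp hV
  have key : ∀ u v : Fin n → ℝ, V * realDiagonal u * Vᴴ * (V * realDiagonal v * Vᴴ) =
      V * realDiagonal (fun i => u i * v i) * Vᴴ := fun u v => by
    calc _ = V * realDiagonal u * (Vᴴ * V) * realDiagonal v * Vᴴ := by
          simp only [Matrix.mul_assoc]
      _ = _ := by
        rw [hVV, Matrix.mul_one, Matrix.mul_assoc V, diagonal_mul_diagonal]
        simp only [realDiagonal, Complex.ofReal_mul]
  have tr : ∀ u : Fin n → ℝ, (V * realDiagonal u * Vᴴ).trace = ∑ i, (u i : ℂ) := fun u => by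
    rw [trace_mul_comm, ← Matrix.mul_assoc, hVV, Matrix.one_mul, trace_diagonal]
  refine ⟨V * realDiagonal (fun i => if i.val < k then 1 else 0) * Vᴴ, ?_, ?_, ?_, ?_, ?_⟩
  · exact (posSemidef_realDiagonal fun i => by split_ifs <;> norm_num).mul_mul_conjTranspose_same V
  · have : 1 - V * realDiagonal (fun i => if i.val < k then 1 else 0) * Vᴴ =
        V * realDiagonal (fun i => if i.val < k then 0 else 1) * Vᴴ := by
      rw [sub_eq_iff_eq_add, ← Matrix.add_mul, ← Matrix.mul_add, diagonal_add]
      have : (fun i : Fin n => (((if i.val < k then 0 else 1 : ℝ)) : ℂ) +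
          ((if i.val < k then 1 else 0 : ℝ) : ℂ)) = fun _ => 1 := by
        ext i; split_ifs <;> simp
      rw [this, diagonal_one, Matrix.mul_one, hVV']
    rw [this]
    exact (posSemidef_realDiagonal fun i => by split_ifs <;> norm_num).mul_mul_conjTranspose_same V
  · rw [tr]
    simp [apply_ite Complex.ofReal, Fin.card_filter_val_lt, hkn]
  · conv_lhs => rw [h, key, tr]
    simp [Finset.sum_filter]
  · conv_lhs => rw [h, key, key, tr]
    simp [Finset.sum_filter, sq]

/-! ### Lyapunov equations. -/

/-- Positivity of the solution of a Lyapunov equation with positive diagonal coefficients. -/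
lemma posSemidef_of_lyapunov {n : ℕ} {c d : Fin n → ℝ} (hc : ∀ i, 0 < c i) (hd : ∀ i, 0 < d i)
    {Y : Matrix (Fin n) (Fin n) ℂ} (hY : Y.IsHermitian)
    (h : (realDiagonal d * Y * realDiagonal c + realDiagonal c * Y * realDiagonal d).PosSemidef) :
    Y.PosSemidef := by
  rw [hY.posSemidef_iff_eigenvalues_nonneg]
  intro j
  set μ := hY.eigenvalues j
  set v : Fin n → ℂ := ⇑(hY.eigenvectorBasis j) with hv
  have hYv : Y *ᵥ v = (μ : ℂ) • v := by
    have := hY.mulVec_eigenvectorBasis j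
    rw [this]
    ext i
    simp [μ, hv]
  have hvY : star v ᵥ* Y = (μ : ℂ) • star v := by
    have := congrArg star hYv
    rw [star_mulVec, hY.eq] at this
    rw [this]
    ext i
    simp
  have hv0 : v ≠ 0 := fun h0 => by
    have h1 := hY.eigenvectorBasis.orthonormal.ne_zero j
    apply h1
    ext i
    exact congrFun h0 i
  obtain ⟨i₀, hi₀⟩ := Function.ne_iff.mp hv0
  -- Testing on `c⁻¹v`, with `v` an eigenvector for `μ`, makes both terms equal to `μ⟨v, (d/c)v⟩`,
  -- so `μ` inherits the sign.
  have hpos := h.dotProduct_mulVec_nonneg (realDiagonal (fun i => (c i)⁻¹) *ᵥ v)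
  have hcc : realDiagonal c * realDiagonal (fun i => (c i)⁻¹) = 1 := by
    rw [diagonal_mul_diagonal, ← diagonal_one]
    congr 1
    ext i
    rw [← Complex.ofReal_mul, mul_inv_cancel₀ (hc i).ne']
    simp
  have hcc' : realDiagonal (fun i => (c i)⁻¹) * realDiagonal c = 1 := by
    rw [diagonal_mul_diagonal, ← diagonal_one]
    congr 1
    ext i
    rw [← Complex.ofReal_mul, inv_mul_cancel₀ (hc i).ne']
    simp
  have hdc : realDiagonal d * realDiagonal (fun i => (c i)⁻¹) =
      realDiagonal (fun i => d i / c i) := by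
    rw [diagonal_mul_diagonal]
    congr 1
    ext i
    push_cast
    rw [div_eq_mul_inv]
  have hdc' : realDiagonal (fun i => (c i)⁻¹) * realDiagonal d =
      realDiagonal (fun i => d i / c i) := by
    rw [diagonal_mul_diagonal]
    congr 1
    ext i
    push_cast
    rw [div_eq_inv_mul]
  have hq : star (realDiagonal (fun i => (c i)⁻¹) *ᵥ v) ⬝ᵥ
      ((realDiagonal d * Y * realDiagonal c + realDiagonal c * Y * realDiagonal d) *ᵥ
        (realDiagonal (fun i => (c i)⁻¹) *ᵥ v)) =
      2 * (μ : ℂ) * (star v ⬝ᵥ (realDiagonal (fun i => d i / c i) *ᵥ v)) := by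
    rw [star_mulVec, (isHermitian_realDiagonal _).eq, ← dotProduct_mulVec, mulVec_mulVec,
      mulVec_mulVec, Matrix.mul_add, Matrix.add_mul]
    have e1 : realDiagonal (fun i => (c i)⁻¹) * (realDiagonal d * Y * realDiagonal c) *
        realDiagonal (fun i => (c i)⁻¹) = realDiagonal (fun i => d i / c i) * Y := by
      rw [← hdc']
      simp only [Matrix.mul_assoc]
      rw [hcc, Matrix.mul_one]
    have e2 : realDiagonal (fun i => (c i)⁻¹) * (realDiagonal c * Y * realDiagonal d) *
        realDiagonal (fun i => (c i)⁻¹) = Y * realDiagonal (fun i => d i / c i) := by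
      rw [← hdc]
      simp only [← Matrix.mul_assoc]
      rw [hcc', Matrix.one_mul]
    rw [e1, e2, add_mulVec, dotProduct_add, ← mulVec_mulVec, hYv, ← mulVec_mulVec,
      dotProduct_mulVec (star v) Y, hvY, mulVec_smul, dotProduct_smul, smul_dotProduct,
      smul_eq_mul]
    ring
  have hval : star v ⬝ᵥ (realDiagonal (fun i => d i / c i) *ᵥ v) =
      ((∑ i, d i / c i * ‖v i‖ ^ 2 : ℝ) : ℂ) := by
    simp only [dotProduct, mulVec_diagonal, Pi.star_apply, RCLike.star_def, Complex.ofReal_sum]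
    refine Finset.sum_congr rfl fun i _ => ?_
    rw [mul_left_comm, Complex.conj_mul']
    push_cast
    ring
  have hs : 0 < ∑ i, d i / c i * ‖v i‖ ^ 2 := by
    refine Finset.sum_pos' (fun i _ => ?_) ⟨i₀, Finset.mem_univ _, ?_⟩
    · have := hc i; have := hd i; positivity
    · have := hc i₀; have := hd i₀
      have : 0 < ‖v i₀‖ := norm_pos_iff.mpr hi₀
      positivity
  rw [hq, hval] at hpos
  have h2 : (0 : ℝ) ≤ 2 * μ * ∑ i, d i / c i * ‖v i‖ ^ 2 := by exact_mod_cast hpos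
  by_contra hneg
  nlinarith [mul_pos (neg_pos.mpr (not_le.mp hneg)) hs]

/-! ### The Schur multiplier and its domination property. -/

/-- The doubled harmonic-type mean of `c` and `d`, the Schur multiplier solving the Lyapunov
equation `d L c + c L d = 2 c d M d c`. -/
noncomputable def lyapunovKernel {n : ℕ} (c d : Fin n → ℝ) (i j : Fin n) : ℝ :=
  2 * (c i * d i * (c j * d j)) / (d i * c j + c i * d j)

/-- The Schur multiplier dominating the Heron mean of `c M c` and `d M d`. -/
noncomputable def heronKernel {n : ℕ} (c d : Fin n → ℝ) (i j : Fin n) : ℝ :=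
  c i * c j + d i * d j + 2 * lyapunovKernel c d i j

/-- Entrywise multiplication by a real kernel. -/
noncomputable def schurMap {n : ℕ} (m : Fin n → Fin n → ℝ) (M : Matrix (Fin n) (Fin n) ℂ) :
    Matrix (Fin n) (Fin n) ℂ :=
  of fun i j => (m i j : ℂ) * M i j

lemma lyapunovKernel_mul {n : ℕ} {c d : Fin n → ℝ} (hc : ∀ i, 0 < c i) (hd : ∀ i, 0 < d i)
    (i j : Fin n) : (d i * c j + c i * d j) * lyapunovKernel c d i j =
      2 * (c i * d i * (c j * d j)) := by
  have : 0 < d i * c j + c i * d j :=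
    add_pos (mul_pos (hd i) (hc j)) (mul_pos (hc i) (hd j))
  rw [lyapunovKernel, mul_div_cancel₀ _ this.ne']

lemma lyapunovKernel_comm {n : ℕ} (c d : Fin n → ℝ) (i j : Fin n) :
    lyapunovKernel c d i j = lyapunovKernel c d j i := by
  rw [lyapunovKernel, lyapunovKernel]
  ring_nf

/-- With `p = d i * c j` and `q = c i * d j`, the Lyapunov kernel is the harmonic mean of `p` and
`q`. Replacing it by the arithmetic mean completes the kernel to `(c i + d i) * (c j + d j) = 1`. -/
lemma heronKernel_le_one {n : ℕ} {c d : Fin n → ℝ} (hc : ∀ i, 0 < c i) (hd : ∀ i, 0 < d i)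
    (hcd : ∀ i, c i + d i = 1) (i j : Fin n) : heronKernel c d i j ≤ 1 := by
  have hpos : 0 < d i * c j + c i * d j :=
    add_pos (mul_pos (hd i) (hc j)) (mul_pos (hc i) (hd j))
  have h1 : 2 * lyapunovKernel c d i j ≤ d i * c j + c i * d j := by
    rw [lyapunovKernel, mul_div_assoc', div_le_iff₀ hpos]
    nlinarith [sq_nonneg (d i * c j - c i * d j)]
  have h2 : (c i + d i) * (c j + d j) = 1 := by rw [hcd, hcd, one_mul]
  rw [heronKernel]
  nlinarith

lemma heronKernel_self {n : ℕ} {c d : Fin n → ℝ} (hc : ∀ i, 0 < c i) (hd : ∀ i, 0 < d i)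
    (hcd : ∀ i, c i + d i = 1) (i : Fin n) : heronKernel c d i i = 1 := by
  have h := lyapunovKernel_mul hc hd i i
  have hpos : 0 < d i * c i + c i * d i :=
    add_pos (mul_pos (hd i) (hc i)) (mul_pos (hc i) (hd i))
  have h1 : lyapunovKernel c d i i = c i * d i := by
    apply mul_left_cancel₀ hpos.ne'
    rw [h]; ring
  rw [heronKernel, h1]
  have h2 : (c i + d i) ^ 2 = 1 := by rw [hcd, one_pow]
  nlinarith

section

variable {n : ℕ} {c d : Fin n → ℝ} {M : Matrix (Fin n) (Fin n) ℂ}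

lemma isHermitian_schurMap_lyapunovKernel (c d : Fin n → ℝ) (hM : M.IsHermitian) :
    (schurMap (lyapunovKernel c d) M).IsHermitian := by
  ext i j
  simp only [conjTranspose_apply, schurMap, of_apply, star_mul', RCLike.star_def,
    Complex.conj_ofReal, lyapunovKernel_comm c d j i]
  rw [← hM.apply i j]
  simp

lemma schurMap_lyapunovKernel_eq (hc : ∀ i, 0 < c i) (hd : ∀ i, 0 < d i)
    (M : Matrix (Fin n) (Fin n) ℂ) :
    realDiagonal d * schurMap (lyapunovKernel c d) M * realDiagonal c +
      realDiagonal c * schurMap (lyapunovKernel c d) M * realDiagonal d =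
    (2 : ℂ) • (realDiagonal (fun i => c i * d i) * M * realDiagonal (fun i => c i * d i)) := by
  ext i j
  have h := congrArg Complex.ofReal (lyapunovKernel_mul hc hd i j)
  push_cast at h
  simp only [Matrix.add_apply, Matrix.smul_apply, mul_diagonal, diagonal_mul, schurMap, of_apply, smul_eq_mul]
  push_cast
  linear_combination M i j * h

lemma schurMap_heronKernel_eq (c d : Fin n → ℝ) (M : Matrix (Fin n) (Fin n) ℂ) :
    schurMap (heronKernel c d) M = realDiagonal c * M * realDiagonal c +
      realDiagonal d * M * realDiagonal d + (2 : ℂ) • schurMap (lyapunovKernel c d) M := by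
  ext i j
  simp only [Matrix.add_apply, Matrix.smul_apply, mul_diagonal, diagonal_mul, schurMap, of_apply, smul_eq_mul,
    heronKernel]
  push_cast
  ring

lemma conj_realDiagonal (hM : M.PosSemidef) (c : Fin n → ℝ) :
    (realDiagonal c * M * realDiagonal c).PosSemidef := by
  have := hM.mul_mul_conjTranspose_same (realDiagonal c)
  rwa [(isHermitian_realDiagonal c).eq] at this

/-- Two of the three summands are congruences of `M`; the third solves a Lyapunov equation whose
right-hand side is a congruence of `M`. -/
lemma posSemidef_schurMap_heronKernel (hc : ∀ i, 0 < c i) (hd : ∀ i, 0 < d i)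
    (hM : M.PosSemidef) : (schurMap (heronKernel c d) M).PosSemidef := by
  have h2 : (0 : ℂ) ≤ 2 := by norm_num
  rw [schurMap_heronKernel_eq]
  refine ((conj_realDiagonal hM c).add (conj_realDiagonal hM d)).add (PosSemidef.smul ?_ h2)
  apply posSemidef_of_lyapunov hc hd (isHermitian_schurMap_lyapunovKernel c d hM.isHermitian)
  rw [schurMap_lyapunovKernel_eq hc hd]
  exact (conj_realDiagonal hM _).smul h2

/-- If `Z` satisfies the block positivity condition for `c M c` and `d M d`, then
`c M c + d M d + 2 Z` is dominated by a Schur multiple of `M`. -/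
lemma posSemidef_schurMap_heronKernel_sub (hc : ∀ i, 0 < c i) (hd : ∀ i, 0 < d i)
    (hM : M.IsHermitian) {Z : Matrix (Fin n) (Fin n) ℂ} (hZ : Z.IsHermitian)
    (h : ((2 : ℂ) • (realDiagonal (fun i => c i * d i) * M * realDiagonal (fun i => c i * d i)) -
      (realDiagonal d * Z * realDiagonal c + realDiagonal c * Z * realDiagonal d)).PosSemidef) :
    (schurMap (heronKernel c d) M - (realDiagonal c * M * realDiagonal c +
      realDiagonal d * M * realDiagonal d + (2 : ℂ) • Z)).PosSemidef := by
  have h2 : (0 : ℂ) ≤ 2 := by norm_num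
  rw [schurMap_heronKernel_eq, add_sub_add_left_eq_sub, ← smul_sub]
  refine PosSemidef.smul (posSemidef_of_lyapunov hc hd
    ((isHermitian_schurMap_lyapunovKernel c d hM).sub hZ) ?_) h2
  rw [← schurMap_lyapunovKernel_eq hc hd] at h
  convert h using 1
  simp only [Matrix.mul_sub, Matrix.sub_mul]
  abel

lemma schurMap_add (m : Fin n → Fin n → ℝ) (M N : Matrix (Fin n) (Fin n) ℂ) :
    schurMap m (M + N) = schurMap m M + schurMap m N := by
  ext i j; simp [schurMap, mul_add]

lemma schurMap_sub (m : Fin n → Fin n → ℝ) (M N : Matrix (Fin n) (Fin n) ℂ) :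
    schurMap m (M - N) = schurMap m M - schurMap m N := by
  ext i j; simp [schurMap, mul_sub]

lemma schurMap_smul_one {m : Fin n → Fin n → ℝ} (hm : ∀ i, m i i = 1) (τ : ℂ) :
    schurMap m (τ • 1) = τ • 1 := by
  ext i j
  by_cases hij : i = j
  · subst hij; simp [schurMap, hm]
  · simp [schurMap, hij]

lemma trace_schurMap {m : Fin n → Fin n → ℝ} (hm : ∀ i, m i i = 1)
    (M : Matrix (Fin n) (Fin n) ℂ) : (schurMap m M).trace = M.trace := by
  simp [Matrix.trace, schurMap, hm]

/-- For Hermitian `M` both traces are sums of `‖M i j‖ ^ 2`, the left one weighted by the kernel. -/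
lemma trace_mul_schurMap_re_le {m : Fin n → Fin n → ℝ} (hm : ∀ i j, m i j ≤ 1)
    (hM : M.IsHermitian) : (M * schurMap m M).trace.re ≤ (M * M).trace.re := by
  simp only [Matrix.trace, diag_apply, Matrix.mul_apply, Complex.re_sum]
  refine Finset.sum_le_sum fun i _ => Finset.sum_le_sum fun j _ => ?_
  have h1 : M i j * M j i = ((‖M i j‖ ^ 2 : ℝ) : ℂ) := by
    rw [← hM.apply j i, RCLike.star_def, Complex.mul_conj']
    push_cast
    rfl
  have h2 : M i j * schurMap m M j i = ((m j i * ‖M i j‖ ^ 2 : ℝ) : ℂ) := by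
    rw [schurMap, of_apply, mul_left_comm, h1]
    push_cast
    rfl
  rw [h1, h2, Complex.ofReal_re, Complex.ofReal_re]
  exact mul_le_of_le_one_left (sq_nonneg _) (hm j i)

end

/-! ### Simultaneous diagonalization by congruence. -/

/-- Two positive definite matrices are simultaneously diagonalized by a congruence `F` that brings
their sum to the identity; `F` is the square root of the sum up to a unitary factor. -/
lemma exists_congruence_diagonal {n : ℕ} {X Y : Matrix (Fin n) (Fin n) ℂ} (hX : X.PosDef)
    (hY : Y.PosDef) : ∃ Q U E : Matrix (Fin n) (Fin n) ℂ, ∃ c d : Fin n → ℝ,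
      Q.IsHermitian ∧ Q * Q = X + Y ∧ U ∈ unitaryGroup (Fin n) ℂ ∧
      E * (Q * U) = 1 ∧ (∀ i, 0 < c i) ∧ (∀ i, 0 < d i) ∧ (∀ i, c i + d i = 1) ∧
      X = Q * U * realDiagonal c * (Q * U)ᴴ ∧ Y = Q * U * realDiagonal d * (Q * U)ᴴ := by
  have hS : (X + Y).PosDef := hX.add hY
  set Q := CFC.sqrt (X + Y)
  have hQQ : Q * Q = X + Y := CFC.sqrt_mul_sqrt_self _ hS.posSemidef.nonneg
  have hQ : Q.IsHermitian := (nonneg_iff_posSemidef.mp (CFC.sqrt_nonneg (X + Y))).isHermitian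
  have hdet : IsUnit Q.det := by
    have := (Matrix.isUnit_iff_isUnit_det _).mp hS.isUnit
    rw [← hQQ, det_mul] at this
    exact isUnit_of_mul_isUnit_left this
  have hQi : Q⁻¹ * Q = 1 := nonsing_inv_mul _ hdet
  have hQi' : Q * Q⁻¹ = 1 := mul_nonsing_inv _ hdet
  have hQiH : (Q⁻¹)ᴴ = Q⁻¹ := by rw [conjTranspose_nonsing_inv, hQ.eq]
  have hC : (Q⁻¹ * X * Q⁻¹).IsHermitian := by
    have := (hX.posSemidef.mul_mul_conjTranspose_same Q⁻¹).isHermitian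
    rwa [hQiH] at this
  obtain ⟨U, hU, hUC⟩ := exists_unitary_diagonalization hC
  set c := eigenvalueVector hC
  have hUU : Uᴴ * U = 1 := mem_unitaryGroup_iff'.mp hU
  have hUU' : U * Uᴴ = 1 := mem_unitaryGroup_iff.mp hU
  have hFH : (Q * U)ᴴ = Uᴴ * Q := by rw [conjTranspose_mul, hQ.eq]
  have hEF : Uᴴ * Q⁻¹ * (Q * U) = 1 := by
    calc _ = Uᴴ * (Q⁻¹ * Q) * U := by simp only [Matrix.mul_assoc]
      _ = 1 := by rw [hQi, Matrix.mul_one, hUU]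
  have hXc : X = Q * U * realDiagonal c * (Q * U)ᴴ := by
    calc X = (Q * Q⁻¹) * X * (Q⁻¹ * Q) := by rw [hQi, hQi', Matrix.one_mul, Matrix.mul_one]
      _ = Q * (Q⁻¹ * X * Q⁻¹) * Q := by simp only [Matrix.mul_assoc]
      _ = _ := by
        rw [hUC, hFH]
        simp only [Matrix.mul_assoc]
  have hYd : Y = Q * U * realDiagonal (fun i => 1 - c i) * (Q * U)ᴴ := by
    have h1 : realDiagonal (fun i => 1 - c i) = 1 - realDiagonal c := by
      ext i j
      by_cases hij : i = j <;> simp [hij]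
    have h2 : Q * U * (Q * U)ᴴ = X + Y := by
      rw [hFH, ← hQQ]
      calc _ = Q * (U * Uᴴ) * Q := by simp only [Matrix.mul_assoc]
        _ = _ := by rw [hUU', Matrix.mul_one]
    rw [h1, Matrix.mul_sub, Matrix.sub_mul, ← hXc, Matrix.mul_one, h2, add_sub_cancel_left]
  have hinj : Function.Injective ((Uᴴ * Q⁻¹).vecMul) := by
    apply Function.LeftInverse.injective (g := (Q * U).vecMul)
    intro v
    change v ᵥ* (Uᴴ * Q⁻¹) ᵥ* (Q * U) = v
    rw [vecMul_vecMul, hEF, vecMul_one]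
  have hpos : ∀ {Z : Matrix (Fin n) (Fin n) ℂ} {x : Fin n → ℝ}, Z.PosDef →
      Z = Q * U * realDiagonal x * (Q * U)ᴴ → ∀ i, 0 < x i := fun {Z x} hZ h i => by
    have h1 := hZ.mul_mul_conjTranspose_same hinj
    have h2 : Uᴴ * Q⁻¹ * Z * (Uᴴ * Q⁻¹)ᴴ = realDiagonal x := by
      rw [h]
      calc _ = (Uᴴ * Q⁻¹ * (Q * U)) * realDiagonal x * (Uᴴ * Q⁻¹ * (Q * U))ᴴ := by
            simp only [conjTranspose_mul, Matrix.mul_assoc]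
        _ = _ := by rw [hEF, conjTranspose_one, Matrix.one_mul, Matrix.mul_one]
    rw [h2, posDef_diagonal_iff] at h1
    simpa using h1 i
  exact ⟨Q, U, Uᴴ * Q⁻¹, c, fun i => 1 - c i, hQ, hQQ, hU, hEF, hpos hX hXc, hpos hY hYd,
    fun i => by ring, hXc, hYd⟩

/-! ### The trace estimate for the Heron mean. -/

section

variable {n : ℕ} {X Y G P V : Matrix (Fin n) (Fin n) ℂ}

/-- The block positivity of `X ^ 2`, `Y ^ 2` and their geometric mean `X G X`, transported by
the congruence `E` and compressed to a commuting pair. -/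
lemma posSemidef_block_compression (hX : X.IsHermitian) (hG : G.IsHermitian)
    (hGY : X * G * (G * X) = Y * Y) (P₁ P₂ : Matrix (Fin n) (Fin n) ℂ) :
    (P₁ᴴ * (X * X) * P₁ - (P₁ᴴ * (X * G * X) * P₂ + P₂ᴴ * (X * G * X) * P₁) +
      P₂ᴴ * (Y * Y) * P₂).PosSemidef := by
  convert posSemidef_conjTranspose_mul_self (X * P₁ - G * X * P₂) using 1
  rw [← hGY]
  simp only [conjTranspose_sub, conjTranspose_mul, hX.eq, hG.eq, Matrix.mul_sub, Matrix.sub_mul,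
    Matrix.mul_assoc]
  abel

/-- The threshold `τ` is kept free: the bound `S ≤ τ + (S - τ)₊` enters once inside `Φ`, once for
`FF* = S`, and once for `M` under the trace. -/
lemma trace_mul_heron_re_le (hX : X.PosDef) (hY : Y.PosDef) (hG : G.IsHermitian)
    (hGY : X * G * (G * X) = Y * Y) (hP : P.PosSemidef) (hP1 : (1 - P).PosSemidef)
    (hV : V ∈ unitaryGroup (Fin n) ℂ) {s : Fin n → ℝ} (hS : X + Y = V * realDiagonal s * Vᴴ)
    {τ : ℝ} (hτ : 0 ≤ τ) :
    (P * (X * X + Y * Y + (2 : ℂ) • (X * G * X))).trace.re ≤ τ ^ 2 * P.trace.re +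
      2 * τ * ∑ i, max (s i - τ) 0 + ∑ i, max (s i - τ) 0 ^ 2 := by
  obtain ⟨Q, U, E, c, d, hQ, hQQ, hU, hEF, hc, hd, hcd, hXc, hYd⟩ :=
    exists_congruence_diagonal hX hY
  set F := Q * U with hF
  have hUU : Uᴴ * U = 1 := mem_unitaryGroup_iff'.mp hU
  have hUU' : U * Uᴴ = 1 := mem_unitaryGroup_iff.mp hU
  have hVV : Vᴴ * V = 1 := mem_unitaryGroup_iff'.mp hV
  have hVV' : V * Vᴴ = 1 := mem_unitaryGroup_iff.mp hV
  have hFE : F * E = 1 := mul_eq_one_comm.mp hEF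
  have hEF' : Fᴴ * Eᴴ = 1 := by rw [← conjTranspose_mul, hEF, conjTranspose_one]
  have hFE' : Eᴴ * Fᴴ = 1 := by rw [← conjTranspose_mul, hFE, conjTranspose_one]
  have hFF : F * Fᴴ = X + Y := by
    rw [hF, conjTranspose_mul, hQ.eq, ← hQQ]
    calc _ = Q * (U * Uᴴ) * Q := by simp only [Matrix.mul_assoc]
      _ = _ := by rw [hUU', Matrix.mul_one]
  set M := Fᴴ * F with hMdef
  have hM : M.PosSemidef := posSemidef_conjTranspose_mul_self F
  have hMS : M = Uᴴ * (X + Y) * U := by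
    rw [hMdef, hF, conjTranspose_mul, hQ.eq, ← hQQ]
    simp only [Matrix.mul_assoc]
  set r : Fin n → ℝ := fun i => max (s i - τ) 0
  have hr : ∀ i, 0 ≤ r i := fun i => le_max_right _ _
  -- the positive part of `S - τ`
  set R := V * realDiagonal r * Vᴴ with hRdef
  have hR : R.PosSemidef := (posSemidef_realDiagonal hr).mul_mul_conjTranspose_same V
  have hSR : ((τ : ℂ) • 1 + R - (X + Y)).PosSemidef := by
    have h1 : (τ : ℂ) • 1 + R - (X + Y) = V * realDiagonal (fun i => τ + r i - s i) * Vᴴ := by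
      have : realDiagonal (fun i => τ + r i - s i) =
          (τ : ℂ) • (1 : Matrix (Fin n) (Fin n) ℂ) + realDiagonal r - realDiagonal s := by
        ext i j
        by_cases hij : i = j <;> simp [hij]
      rw [this, hS, hRdef]
      simp only [Matrix.mul_sub, Matrix.sub_mul, Matrix.mul_add, Matrix.add_mul, Matrix.mul_smul,
        Matrix.smul_mul, Matrix.mul_one, hVV']
    rw [h1]
    exact (posSemidef_realDiagonal fun i => by
      linarith [le_max_left (s i - τ) 0]).mul_mul_conjTranspose_same V
  have hRtr : R.trace.re = ∑ i, r i := by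
    rw [hRdef, trace_mul_comm, ← Matrix.mul_assoc, hVV, Matrix.one_mul, trace_diagonal,
      Complex.re_sum]
    simp
  have hRRtr : (R * R).trace.re = ∑ i, r i ^ 2 := by
    have : R * R = V * realDiagonal (fun i => r i ^ 2) * Vᴴ := by
      calc _ = V * realDiagonal r * (Vᴴ * V) * realDiagonal r * Vᴴ := by
            simp only [hRdef, Matrix.mul_assoc]
        _ = _ := by
          rw [hVV, Matrix.mul_one, Matrix.mul_assoc V, diagonal_mul_diagonal]
          simp only [realDiagonal, Complex.ofReal_mul, sq]
    rw [this, trace_mul_comm, ← Matrix.mul_assoc, hVV, Matrix.one_mul, trace_diagonal,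
      Complex.re_sum]
    simp only [Complex.ofReal_re]
  -- the same in the coordinates of `M`
  set R' := Uᴴ * R * U with hRdef'
  have hR' : R'.PosSemidef := hR.conjTranspose_mul_mul_same U
  have hMR : ((τ : ℂ) • 1 + R' - M).PosSemidef := by
    convert hSR.conjTranspose_mul_mul_same U using 1
    rw [hMS, hRdef']
    simp only [Matrix.mul_sub, Matrix.sub_mul, Matrix.mul_add, Matrix.add_mul, Matrix.mul_smul,
      Matrix.smul_mul, Matrix.mul_one, hUU]
  have hRtr' : R'.trace = R.trace := by
    rw [hRdef', trace_mul_comm, ← Matrix.mul_assoc, hUU', Matrix.one_mul]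
  have hRRtr' : (R' * R').trace = (R * R).trace := by
    have : R' * R' = Uᴴ * (R * R) * U := by
      calc _ = Uᴴ * R * (U * Uᴴ) * R * U := by simp only [hRdef', Matrix.mul_assoc]
        _ = _ := by rw [hUU', Matrix.mul_one]; simp only [Matrix.mul_assoc]
    rw [this, trace_mul_comm, ← Matrix.mul_assoc, hUU', Matrix.one_mul]
  set Φ := schurMap (heronKernel c d) with hΦ
  have hΦ1 : ∀ i, heronKernel c d i i = 1 := heronKernel_self hc hd hcd
  have hΦR : (Φ R').PosSemidef := posSemidef_schurMap_heronKernel hc hd hR'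
  -- the operator inequality
  set Z := E * (X * G * X) * Eᴴ with hZdef
  have hXGX : (X * G * X).IsHermitian := by
    rw [IsHermitian, conjTranspose_mul, conjTranspose_mul, hX.isHermitian.eq, hG.eq,
      Matrix.mul_assoc]
  have hZ : Z.IsHermitian := isHermitian_mul_mul_conjTranspose _ hXGX
  have hsq : ∀ x : Fin n → ℝ, E * (F * realDiagonal x * Fᴴ * (F * realDiagonal x * Fᴴ)) * Eᴴ =
      realDiagonal x * M * realDiagonal x := fun x => by
    calc _ = (E * F) * realDiagonal x * (Fᴴ * F) * realDiagonal x * (Fᴴ * Eᴴ) := by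
          simp only [Matrix.mul_assoc]
      _ = _ := by rw [hEF, hEF', Matrix.one_mul, Matrix.mul_one]
  have hXX : E * (X * X) * Eᴴ = realDiagonal c * M * realDiagonal c := by
    conv_lhs => rw [hXc]
    exact hsq c
  have hYY : E * (Y * Y) * Eᴴ = realDiagonal d * M * realDiagonal d := by
    conv_lhs => rw [hYd]
    exact hsq d
  -- The weights are crossed, `d` with `X` and `c` with `Y`, so that both square terms become
  -- `cdMcd`.
  have hblock := posSemidef_block_compression hX.isHermitian hG hGY (Eᴴ * realDiagonal d)
    (Eᴴ * realDiagonal c)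
  have hcc : realDiagonal c * realDiagonal d = realDiagonal (fun i => c i * d i) := by
    rw [diagonal_mul_diagonal]
    simp only [realDiagonal, Complex.ofReal_mul]
  have hcc' : realDiagonal d * realDiagonal c = realDiagonal (fun i => c i * d i) := by
    rw [diagonal_mul_diagonal]
    simp only [realDiagonal, Complex.ofReal_mul, mul_comm]
  have hdom := posSemidef_schurMap_heronKernel_sub hc hd hM.isHermitian hZ (by
    convert hblock using 1
    have key : ∀ (u v : Fin n → ℝ) (B : Matrix (Fin n) (Fin n) ℂ),
        (Eᴴ * realDiagonal u)ᴴ * B * (Eᴴ * realDiagonal v) =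
          realDiagonal u * (E * B * Eᴴ) * realDiagonal v := fun u v B => by
      rw [conjTranspose_mul, conjTranspose_conjTranspose, (isHermitian_realDiagonal u).eq]
      simp only [Matrix.mul_assoc]
    rw [key, key, key, key, hXX, hYY, ← hZdef]
    have e1 : realDiagonal d * (realDiagonal c * M * realDiagonal c) * realDiagonal d =
        realDiagonal (fun i => c i * d i) * M * realDiagonal (fun i => c i * d i) := by
      calc _ = (realDiagonal d * realDiagonal c) * M * (realDiagonal c * realDiagonal d) := by
            simp only [Matrix.mul_assoc]
        _ = _ := by rw [hcc, hcc']
    have e2 : realDiagonal c * (realDiagonal d * M * realDiagonal d) * realDiagonal c =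
        realDiagonal (fun i => c i * d i) * M * realDiagonal (fun i => c i * d i) := by
      calc _ = (realDiagonal c * realDiagonal d) * M * (realDiagonal d * realDiagonal c) := by
            simp only [Matrix.mul_assoc]
        _ = _ := by rw [hcc, hcc']
    rw [e1, e2, two_smul]
    abel)
  have hmono : (Φ ((τ : ℂ) • 1 + R' - M)).PosSemidef :=
    posSemidef_schurMap_heronKernel hc hd hMR
  rw [hΦ, schurMap_sub, schurMap_add, schurMap_smul_one hΦ1, ← hΦ] at hmono
  have hT := (hmono.add hdom).mul_mul_conjTranspose_same F
  have hback : ∀ B : Matrix (Fin n) (Fin n) ℂ, F * (E * B * Eᴴ) * Fᴴ = B := fun B => by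
    calc _ = (F * E) * B * (Eᴴ * Fᴴ) := by simp only [Matrix.mul_assoc]
      _ = B := by rw [hFE, hFE', Matrix.one_mul, Matrix.mul_one]
  have hT' : ((τ : ℂ) • (X + Y) + F * Φ R' * Fᴴ -
      (X * X + Y * Y + (2 : ℂ) • (X * G * X))).PosSemidef := by
    convert hT using 1
    rw [← hXX, ← hYY, hZdef, sub_add_sub_cancel]
    simp only [Matrix.mul_sub, Matrix.sub_mul, Matrix.mul_add, Matrix.add_mul, Matrix.mul_smul,
      Matrix.smul_mul, Matrix.mul_one, hback, hFF]
  have hτ' : (0 : ℂ) ≤ τ := by exact_mod_cast hτ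
  have hfin : ((τ : ℂ) • ((τ : ℂ) • 1 + R) + F * Φ R' * Fᴴ -
      (X * X + Y * Y + (2 : ℂ) • (X * G * X))).PosSemidef := by
    convert (hSR.smul hτ').add hT' using 1
    rw [smul_sub]
    abel
  -- traces
  have t1 := trace_mul_re_nonneg hP hfin
  have t2 := trace_mul_re_le_trace_re hP1 hR
  have t3 := trace_mul_re_le_trace_re hP1 (hΦR.mul_mul_conjTranspose_same F)
  have t4 : (F * Φ R' * Fᴴ).trace = (M * Φ R').trace := by
    rw [trace_mul_comm, ← Matrix.mul_assoc]
  -- Gives `tr MΦ(R') ≤ τ tr Φ(R') + tr R'Φ(R')`; the unit diagonal of the kernel evaluates the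
  -- first term and its bound by `1` controls the second.
  have t5 := trace_mul_re_nonneg hMR hΦR
  have t6 : (Φ R').trace = R'.trace := trace_schurMap hΦ1 _
  have t7 : (R' * Φ R').trace.re ≤ (R' * R').trace.re :=
    trace_mul_schurMap_re_le (heronKernel_le_one hc hd hcd) hR'.isHermitian
  rw [Matrix.sub_mul, Matrix.add_mul, Matrix.smul_mul, Matrix.one_mul, trace_sub, trace_add,
    trace_smul, t6, hRtr'] at t5
  rw [Matrix.mul_sub, Matrix.mul_add, Matrix.mul_smul, Matrix.mul_add, Matrix.mul_smul,
    Matrix.mul_one, trace_sub, trace_add, trace_smul, trace_add, trace_smul] at t1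
  rw [hRRtr', hRRtr] at t7
  rw [t4] at t3
  rw [hRtr] at t2
  simp only [Complex.add_re, Complex.sub_re, smul_eq_mul, Complex.re_ofReal_mul, hRtr] at t1 t5
  have t8 := mul_le_mul_of_nonneg_left t2 hτ
  nlinarith

end

/-! ### Weak majorization for the Heron mean. -/

lemma weaklyMajorizedBy_heron {n : ℕ} {X Y G : Matrix (Fin n) (Fin n) ℂ} (hX : X.PosDef)
    (hY : Y.PosDef) (hG : G.IsHermitian) (hGY : X * G * (G * X) = Y * Y)
    (hT : (X * X + Y * Y + (2 : ℂ) • (X * G * X)).IsHermitian)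
    (hK : ((X + Y) * (X + Y)).IsHermitian) :
    WeaklyMajorizedBy (eigenvalueVector hT) (eigenvalueVector hK) := by
  rw [weaklyMajorizedBy_iff_of_antitone (eigenvalueVector_antitone hT)
    (eigenvalueVector_antitone hK)]
  intro k hk hkn
  have hS : (X + Y).PosSemidef := (hX.add hY).posSemidef
  obtain ⟨V, hV, hSV⟩ := exists_unitary_diagonalization hS.isHermitian
  set s := eigenvalueVector hS.isHermitian
  have hs : Antitone s := eigenvalueVector_antitone hS.isHermitian
  set τ := s ⟨k - 1, by omega⟩
  have hτ : 0 ≤ τ := eigenvalueVector_nonneg hS _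
  obtain ⟨P, hP, hP1, hPtr, hPT, -⟩ := exists_projection_trace_mul_eq hT hkn
  -- Testing `S²` on a spectral projection of `S` avoids identifying the sorted eigenvalues of `S²`
  -- with the squares of those of `S`.
  obtain ⟨P', hP', hP1', hPtr', -, hPS⟩ := exists_projection_trace_mul_eq hS.isHermitian hkn
  have h1 := trace_mul_heron_re_le hX hY hG hGY hP hP1 hV hSV hτ
  have h2 := trace_mul_re_le_sum_eigenvalueVector hK hP' hP1' hk hkn hPtr'
  have h3 := sum_max_sub_eq hs hk hkn id rfl
  have h4 := sum_max_sub_eq hs hk hkn (· ^ 2) (by norm_num)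
  simp only [id] at h3
  rw [h3, h4, hPtr, Complex.natCast_re, hPT] at h1
  rw [hPS] at h2
  refine (h1.trans_eq ?_).trans h2
  have hcard : (k : ℝ) = ∑ i with (i : Fin n).val < k, (1 : ℝ) := by
    rw [Finset.sum_const, card_filter_val_lt hkn, nsmul_eq_mul, mul_one]
  rw [hcard, Finset.mul_sum, Finset.mul_sum, ← Finset.sum_add_distrib, ← Finset.sum_add_distrib]
  -- Termwise, `τ² + 2τ(s - τ) + (s - τ)² = s²`.
  exact Finset.sum_congr rfl fun i _ => by ring

lemma posSemidef_heron {n : ℕ} {X Y G : Matrix (Fin n) (Fin n) ℂ} (hX : X.IsHermitian)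
    (hG : G.IsHermitian) (hGY : X * G * (G * X) = Y * Y) :
    (X * X + Y * Y + (2 : ℂ) • (X * G * X)).PosSemidef := by
  convert posSemidef_conjTranspose_mul_self (X + G * X) using 1
  rw [← hGY, two_smul]
  simp only [conjTranspose_add, conjTranspose_mul, hX.eq, hG.eq, Matrix.mul_add, Matrix.add_mul,
    Matrix.mul_assoc]
  abel

/-! ### Weak majorization and convex hulls of signed permutations. -/

/-- Summation by parts for a decreasing sequence of weights. -/
lemma mul_sum_le_sum_mul_of_antitone {n : ℕ} {f z : Fin n → ℝ} (hf : Antitone f) {t : ℝ}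
    (ht : ∀ i, t ≤ f i)
    (hz : ∀ k : ℕ, 1 ≤ k → k ≤ n → 0 ≤ ∑ j with (j : Fin n).val < k, z j) :
    t * ∑ i, z i ≤ ∑ i, f i * z i := by
  induction n generalizing t with
  | zero => simp
  | succ n ih =>
    -- The lower bound for the shortened sequence is the last weight, so adding the last term yields
    -- that weight times the full sum of `z`.
    have h1 := ih (f := fun i => f i.castSucc) (z := fun i => z i.castSucc)
      (fun i j hij => hf (Fin.castSucc_le_castSucc_iff.mpr hij)) (t := f (Fin.last n))
      (fun i => hf (Fin.le_last _)) (fun k hk hkn => by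
        have := hz k hk (by omega)
        rw [Finset.sum_filter, Fin.sum_univ_castSucc] at this
        rw [Finset.sum_filter]
        simpa [Nat.not_lt.mpr hkn] using this)
    have h2 := hz (n + 1) (by omega) le_rfl
    rw [Finset.filter_true_of_mem (fun j _ => j.isLt)] at h2
    have h3 := mul_le_mul_of_nonneg_right (ht (Fin.last n)) h2
    rw [Fin.sum_univ_castSucc (fun i => f i * z i)]
    rw [Fin.sum_univ_castSucc] at h3 ⊢
    nlinarith

/-- A nonnegative vector weakly majorized by another one is a convex combination of signed
permutations of the latter. -/
lemma mem_convexHull_signed_perm {n : ℕ} {x y : Fin n → ℝ} (hx : Antitone x)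
    (hx0 : ∀ i, 0 ≤ x i) (hy : Antitone y) (h : WeaklyMajorizedBy x y) :
    x ∈ convexHull ℝ (Set.range fun p : Equiv.Perm (Fin n) × (Fin n → ℤˣ) =>
      fun i => ((p.2 i : ℤ) : ℝ) * y (p.1 i)) := by
  by_contra hmem
  obtain ⟨f, u, hlt, hgt⟩ := geometric_hahn_banach_closed_point (convex_convexHull ℝ _)
    ((Set.finite_range _).isClosed_convexHull ℝ) hmem
  have hf : ∀ v : Fin n → ℝ, f v = ∑ i, f (Pi.single i 1) * v i := fun v => by
    conv_lhs => rw [← Finset.univ_sum_single v]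
    rw [map_sum]
    refine Finset.sum_congr rfl fun i _ => ?_
    have : (Pi.single i (v i) : Fin n → ℝ) = v i • Pi.single i (1 : ℝ) := by
      rw [← Pi.single_smul, smul_eq_mul, mul_one]
    rw [this, map_smul, smul_eq_mul, mul_comm]
  -- With `|a|` sorted decreasingly, rearrangement and summation by parts bound `f x` by the value
  -- of `f` at a signed permutation of `y`, contradicting separation.
  set a : Fin n → ℝ := fun i => f (Pi.single i 1)
  set g : Fin n → ℝ := fun i => |a i|
  set σ : Equiv.Perm (Fin n) := Fin.revPerm.trans (Tuple.sort g)
  have hσ : Antitone (g ∘ σ) := fun i j hij =>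
    Tuple.monotone_sort g (Fin.rev_le_rev.mpr hij)
  have hmaj := (weaklyMajorizedBy_iff_of_antitone hx hy).mp h
  have h1 : ∑ i, a i * x i ≤ ∑ i, g i * x i :=
    Finset.sum_le_sum fun i _ => mul_le_mul_of_nonneg_right (le_abs_self _) (hx0 i)
  have h2 : ∑ i, g i * x i ≤ ∑ i, (g ∘ σ) i * x i := by
    have := (hσ.monovary hx).sum_comp_perm_mul_le_sum_mul (σ := σ⁻¹)
    simpa using this
  have h3 : 0 * ∑ i, (y i - x i) ≤ ∑ i, (g ∘ σ) i * (y i - x i) :=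
    mul_sum_le_sum_mul_of_antitone hσ (fun i => abs_nonneg _) fun k hk hkn => by
      rw [Finset.sum_sub_distrib]
      exact sub_nonneg.mpr (hmaj k hk hkn)
  have h4 : ∑ i, (g ∘ σ) i * y i = ∑ i, g i * y (σ⁻¹ i) := by
    rw [← Equiv.sum_comp σ fun i => g i * y (σ⁻¹ i)]
    simp
  have hε : ∀ i, ∃ e : ℤˣ, a i * ((e : ℤ) : ℝ) = g i := fun i => by
    rcases le_total 0 (a i) with hi | hi
    · exact ⟨1, by simp [g, abs_of_nonneg hi]⟩
    · exact ⟨-1, by simp [g, abs_of_nonpos hi]⟩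
  choose e he using hε
  have h5 := hlt _ (subset_convexHull ℝ _ ⟨(σ⁻¹, e), rfl⟩)
  rw [hf] at h5 hgt
  have h6 : ∑ i, a i * (((e i : ℤ) : ℝ) * y (σ⁻¹ i)) = ∑ i, g i * y (σ⁻¹ i) :=
    Finset.sum_congr rfl fun i _ => by rw [← mul_assoc, he]
  simp only [mul_sub, Finset.sum_sub_distrib] at h3
  have h5' : ∑ i, a i * (((e i : ℤ) : ℝ) * y (σ⁻¹ i)) < u := h5
  have hgt' : u < ∑ i, a i * x i := hgt
  linarith

/-! ### Ky Fan's dominance principle. -/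

namespace IsUnitarilyInvariantNorm

variable {n : ℕ} {N : Matrix (Fin n) (Fin n) ℂ → ℝ}

lemma conj_unitary (hN : IsUnitarilyInvariantNorm N) {V : Matrix (Fin n) (Fin n) ℂ}
    (hV : V ∈ unitaryGroup (Fin n) ℂ) (A : Matrix (Fin n) (Fin n) ℂ) :
    N (V * A * Vᴴ) = N A :=
  hN.unitary_mul_mul V hV _ (Unitary.star_mem hV) A

lemma realDiagonal_signed_perm (hN : IsUnitarilyInvariantNorm N) (y : Fin n → ℝ)
    (σ : Equiv.Perm (Fin n)) (e : Fin n → ℤˣ) :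
    N (realDiagonal fun i => ((e i : ℤ) : ℝ) * y (σ i)) = N (realDiagonal y) := by
  obtain ⟨W, hW, h⟩ := exists_unitary_conj_realDiagonal_comp σ
  have hE : realDiagonal (fun i => ((e i : ℤ) : ℝ)) ∈ unitaryGroup (Fin n) ℂ := by
    rw [mem_unitaryGroup_iff, star_eq_conjTranspose, (isHermitian_realDiagonal _).eq,
      diagonal_mul_diagonal, ← diagonal_one]
    congr 1
    ext i
    rcases Int.units_eq_one_or (e i) with hi | hi <;> simp [hi]
  have hsplit : realDiagonal (fun i => ((e i : ℤ) : ℝ) * y (σ i)) =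
      realDiagonal (fun i => ((e i : ℤ) : ℝ)) * realDiagonal (y ∘ σ) * 1 := by
    rw [Matrix.mul_one, diagonal_mul_diagonal]
    simp only [realDiagonal, Complex.ofReal_mul, Function.comp]
  rw [hsplit, hN.unitary_mul_mul _ hE 1 (one_mem _), h, hN.conj_unitary hW]

lemma convex_sublevel_realDiagonal (hN : IsUnitarilyInvariantNorm N) (r : ℝ) :
    Convex ℝ {v : Fin n → ℝ | N (realDiagonal v) ≤ r} := by
  intro v hv w hw a b ha hb hab
  have hsplit : realDiagonal (a • v + b • w) =
      (a : ℂ) • realDiagonal v + (b : ℂ) • realDiagonal w := by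
    ext i j
    by_cases hij : i = j <;> simp [hij]
  have h1 := hN.add_le ((a : ℂ) • realDiagonal v) ((b : ℂ) • realDiagonal w)
  rw [hN.smul_eq, hN.smul_eq, Complex.norm_of_nonneg ha, Complex.norm_of_nonneg hb] at h1
  rw [Set.mem_ofPred_eq] at hv hw ⊢
  rw [hsplit]
  calc _ ≤ _ := h1
    _ ≤ a * r + b * r := by gcongr
    _ = r := by rw [← add_mul, hab, one_mul]

/-- Ky Fan's dominance principle for positive semidefinite matrices. -/
theorem le_of_weaklyMajorizedBy (hN : IsUnitarilyInvariantNorm N)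
    {H K : Matrix (Fin n) (Fin n) ℂ} (hH : H.PosSemidef) (hK : K.IsHermitian)
    (h : WeaklyMajorizedBy (eigenvalueVector hH.isHermitian) (eigenvalueVector hK)) :
    N H ≤ N K := by
  obtain ⟨V, hV, hHV⟩ := exists_unitary_diagonalization hH.isHermitian
  obtain ⟨W, hW, hKW⟩ := exists_unitary_diagonalization hK
  have hmem := mem_convexHull_signed_perm (eigenvalueVector_antitone _)
    (eigenvalueVector_nonneg hH) (eigenvalueVector_antitone _) h
  have hsub := convexHull_min (s := Set.range fun p : Equiv.Perm (Fin n) × (Fin n → ℤˣ) =>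
      fun i => ((p.2 i : ℤ) : ℝ) * eigenvalueVector hK (p.1 i))
    (by
      rintro _ ⟨p, rfl⟩
      exact (hN.realDiagonal_signed_perm (eigenvalueVector hK) p.1 p.2).le)
    (hN.convex_sublevel_realDiagonal (N (realDiagonal (eigenvalueVector hK))))
  calc N H = N (realDiagonal (eigenvalueVector hH.isHermitian)) := by
        conv_lhs => rw [hHV, hN.conj_unitary hV]
    _ ≤ N (realDiagonal (eigenvalueVector hK)) := hsub hmem
    _ = N K := by conv_rhs => rw [hKW, hN.conj_unitary hW]

end IsUnitarilyInvariantNorm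

/-! ### Application to the geometric mean. -/

section

variable {n : ℕ} {A B : Matrix (Fin n) (Fin n) ℂ}

lemma rpow_half_mul_self (hA : A.PosSemidef) : A ^ (1 / 2 : ℝ) * A ^ (1 / 2 : ℝ) = A := by
  rw [← CFC.sqrt_eq_rpow]
  exact CFC.sqrt_mul_sqrt_self A hA.nonneg

lemma posDef_rpow_half (hA : A.PosDef) : (A ^ (1 / 2 : ℝ)).PosDef := by
  have h : (A ^ (1 / 2 : ℝ)).PosSemidef := nonneg_iff_posSemidef.mp CFC.rpow_nonneg
  exact h.posDef_iff_isUnit.mpr (hA.isUnit.cfcRpow _ hA.posSemidef.nonneg)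

/-- The geometric mean in the form `X G X`, with `X` the square root of `A`. -/
lemma exists_geometricMean_eq (hA : A.PosDef) (hB : B.PosDef) :
    ∃ G : Matrix (Fin n) (Fin n) ℂ, G.IsHermitian ∧
      geometricMean A B = A ^ (1 / 2 : ℝ) * G * A ^ (1 / 2 : ℝ) ∧
      A ^ (1 / 2 : ℝ) * G * (G * A ^ (1 / 2 : ℝ)) = B := by
  have hA' : IsStrictlyPositive A := isStrictlyPositive_iff_posDef.mpr hA
  have hneg : (A ^ (-(1 / 2) : ℝ)).PosSemidef := nonneg_iff_posSemidef.mp CFC.rpow_nonneg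
  have hC : (A ^ (-(1 / 2) : ℝ) * B * A ^ (-(1 / 2) : ℝ)).PosSemidef := by
    have := hB.posSemidef.mul_mul_conjTranspose_same (A ^ (-(1 / 2) : ℝ))
    rwa [hneg.isHermitian.eq] at this
  refine ⟨(A ^ (-(1 / 2) : ℝ) * B * A ^ (-(1 / 2) : ℝ)) ^ (1 / 2 : ℝ),
    (nonneg_iff_posSemidef.mp CFC.rpow_nonneg).isHermitian, rfl, ?_⟩
  rw [Matrix.mul_assoc, ← Matrix.mul_assoc _ _ (A ^ (1 / 2 : ℝ)), rpow_half_mul_self hC]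
  calc _ = A ^ (1 / 2 : ℝ) * A ^ (-(1 / 2) : ℝ) * B * (A ^ (-(1 / 2) : ℝ) * A ^ (1 / 2 : ℝ)) := by
        simp only [Matrix.mul_assoc]
    _ = B := by
      rw [CFC.rpow_mul_rpow_neg _ hA', CFC.rpow_neg_mul_rpow _ hA', Matrix.one_mul, Matrix.mul_one]

lemma heron_arithmetic_eq_sq (hA : A.PosDef) (hB : B.PosDef) (a b : ℝ) :
    a ^ 2 • A + b ^ 2 • B
        + (a * b) • (A ^ (1 / 2 : ℝ) * B ^ (1 / 2 : ℝ) + B ^ (1 / 2 : ℝ) * A ^ (1 / 2 : ℝ))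
      = (a • A ^ (1 / 2 : ℝ) + b • B ^ (1 / 2 : ℝ)) ^ 2 := by
  rw [sq (a • _ + _)]
  simp only [Matrix.mul_add, Matrix.add_mul, Matrix.smul_mul, Matrix.mul_smul, smul_smul,
    rpow_half_mul_self hA.posSemidef, rpow_half_mul_self hB.posSemidef, smul_add, mul_comm b a, sq]
  abel

lemma weaklyMajorizedBy_heron_geometricMean (hA : A.PosDef) (hB : B.PosDef) {a b : ℝ}
    (ha : 0 ≤ a) (hb : 0 ≤ b) :
    ∃ (hH : (a ^ 2 • A + b ^ 2 • B + (2 * a * b) • geometricMean A B).PosSemidef)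
      (hK : ((a • A ^ (1 / 2 : ℝ) + b • B ^ (1 / 2 : ℝ)) ^ 2).IsHermitian),
      WeaklyMajorizedBy (eigenvalueVector hH.isHermitian) (eigenvalueVector hK) := by
  have hX := posDef_rpow_half hA
  have hY := posDef_rpow_half hB
  have hS : (a • A ^ (1 / 2 : ℝ) + b • B ^ (1 / 2 : ℝ)).PosSemidef :=
    (hX.posSemidef.smul ha).add (hY.posSemidef.smul hb)
  have hK : ((a • A ^ (1 / 2 : ℝ) + b • B ^ (1 / 2 : ℝ)) ^ 2).PosSemidef := hS.pow 2
  -- When `ab = 0` the cross terms vanish and the two matrices coincide; otherwise `aA^{1/2}` and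
  -- `bB^{1/2}` are positive definite and `b / a` makes sense.
  by_cases hab : a * b = 0
  · have heq : a ^ 2 • A + b ^ 2 • B + (2 * a * b) • geometricMean A B =
        (a • A ^ (1 / 2 : ℝ) + b • B ^ (1 / 2 : ℝ)) ^ 2 := by
      rw [← heron_arithmetic_eq_sq hA hB, mul_assoc, hab, mul_zero, zero_smul, zero_smul]
    rw [heq]
    exact ⟨hK, hK.isHermitian, fun _ _ _ => le_rfl⟩
  · have ha' : 0 < a := ha.lt_of_ne' (left_ne_zero_of_mul hab)
    have hb' : 0 < b := hb.lt_of_ne' (right_ne_zero_of_mul hab)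
    obtain ⟨G, hG, hmean, hGB⟩ := exists_geometricMean_eq hA hB
    have hX' := hX.smul ha'
    have hY' := hY.smul hb'
    have hG' : ((b / a) • G).IsHermitian := by
      rw [IsHermitian, conjTranspose_smul, hG.eq, star_trivial]
    -- The factor `b / a` is forced by `a²(b/a)² = b²`, and it turns `XGX` into `ab(A # B)`.
    have hGY : a • A ^ (1 / 2 : ℝ) * ((b / a) • G) * ((b / a) • G * a • A ^ (1 / 2 : ℝ)) =
        b • B ^ (1 / 2 : ℝ) * b • B ^ (1 / 2 : ℝ) := by
      simp only [Matrix.smul_mul, Matrix.mul_smul, smul_smul, rpow_half_mul_self hB.posSemidef, hGB]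
      congr 1
      field_simp
    have heq : a ^ 2 • A + b ^ 2 • B + (2 * a * b) • geometricMean A B =
        a • A ^ (1 / 2 : ℝ) * a • A ^ (1 / 2 : ℝ) + b • B ^ (1 / 2 : ℝ) * b • B ^ (1 / 2 : ℝ) +
          (2 : ℂ) • (a • A ^ (1 / 2 : ℝ) * ((b / a) • G) * a • A ^ (1 / 2 : ℝ)) := by
      rw [hmean, two_smul, ← two_smul ℝ]
      simp only [Matrix.smul_mul, Matrix.mul_smul, smul_smul, rpow_half_mul_self hA.posSemidef,
        rpow_half_mul_self hB.posSemidef, sq]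
      congr 2
      field_simp
    have hT := posSemidef_heron hX'.isHermitian hG' hGY
    rw [heq]
    rw [sq (a • _ + _)] at hK ⊢
    exact ⟨hT, hK.isHermitian, weaklyMajorizedBy_heron hX' hY' hG' hGY hT.isHermitian
      hK.isHermitian⟩

end

end HeronMajorization

theorem mainTheorem4 {n : ℕ} (A B : Matrix (Fin n) (Fin n) ℂ) (hA : A.PosDef) (hB : B.PosDef)
    (a b : ℝ) (ha : 0 ≤ a) (hb : 0 ≤ b) :
    (∃ (hH : (a ^ 2 • A + b ^ 2 • B
          + (2 * a * b) • HeronMajorization.geometricMean A B).IsHermitian)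
        (hK : (a ^ 2 • A + b ^ 2 • B
          + (a * b) • (A ^ (1 / 2 : ℝ) * B ^ (1 / 2 : ℝ)
            + B ^ (1 / 2 : ℝ) * A ^ (1 / 2 : ℝ))).IsHermitian),
      HeronMajorization.WeaklyMajorizedBy
        (HeronMajorization.eigenvalueVector hH) (HeronMajorization.eigenvalueVector hK)) ∧
    a ^ 2 • A + b ^ 2 • B
        + (a * b) • (A ^ (1 / 2 : ℝ) * B ^ (1 / 2 : ℝ) + B ^ (1 / 2 : ℝ) * A ^ (1 / 2 : ℝ))
      = (a • A ^ (1 / 2 : ℝ) + b • B ^ (1 / 2 : ℝ)) ^ 2 ∧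
    (∀ N : Matrix (Fin n) (Fin n) ℂ → ℝ, HeronMajorization.IsUnitarilyInvariantNorm N →
      N (a ^ 2 • A + b ^ 2 • B + (2 * a * b) • HeronMajorization.geometricMean A B)
        ≤ N ((a • A ^ (1 / 2 : ℝ) + b • B ^ (1 / 2 : ℝ)) ^ 2)) ∧
    (∀ N : Matrix (Fin n) (Fin n) ℂ → ℝ, HeronMajorization.IsUnitarilyInvariantNorm N →
      N (A + B + (2 : ℝ) • HeronMajorization.geometricMean A B)
        ≤ N (A + B + A ^ (1 / 2 : ℝ) * B ^ (1 / 2 : ℝ)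
          + B ^ (1 / 2 : ℝ) * A ^ (1 / 2 : ℝ))) := by
  open HeronMajorization in
  have key : ∀ {a b : ℝ}, 0 ≤ a → 0 ≤ b → ∀ N : Matrix (Fin n) (Fin n) ℂ → ℝ,
      IsUnitarilyInvariantNorm N →
      N (a ^ 2 • A + b ^ 2 • B + (2 * a * b) • geometricMean A B)
        ≤ N ((a • A ^ (1 / 2 : ℝ) + b • B ^ (1 / 2 : ℝ)) ^ 2) := fun ha hb N hN => by
    obtain ⟨hH, hK, h⟩ := weaklyMajorizedBy_heron_geometricMean hA hB ha hb
    exact hN.le_of_weaklyMajorizedBy hH hK h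
  have hsq := HeronMajorization.heron_arithmetic_eq_sq hA hB
  refine ⟨?_, hsq a b, key ha hb, fun N hN => ?_⟩
  · rw [hsq a b]
    obtain ⟨hH, hK, h⟩ := HeronMajorization.weaklyMajorizedBy_heron_geometricMean hA hB ha hb
    exact ⟨hH.isHermitian, hK, h⟩
  · have h := key zero_le_one zero_le_one N hN
    rw [← hsq 1 1] at h
    simpa only [one_pow, one_smul, mul_one, ← add_assoc] using h
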